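/- Let $(\Omega,\mathcal G,\mathbb P)$ be a complete probability space carrying a standard one-dimensional Brownian motion $W$, let $\mathbb F$ be the natural filtration of $W$ augmented by the $\mathbb P$-null sets, and let $0\le T<\infty$. Let $b,\beta:[0,T]\times\mathbb R\to\mathbb R$ and $\sigma:[0,T]\to\mathbb R$ be measurable and satisfy, for some constants $K_a,L_a$ and all $t\in[0,T]$, $x,x'\in\mathbb R$, $$|b(t,0)|+|\sigma(t)|+|\beta(t,0)|\le K_a,\qquad |b(t,x)-b(t,x')|+|\beta(t,x)-\beta(t,x')|\le L_a|x-x'| .\qquad\text{(HF)}$$ For $a\in[0,T]$ let $\mathcal S^2_{\mathbb F}[a,T]$ be the set of $\mathbb F$-progressively measurable processes $X$ on $[a,T]$ with $\mathbb E[\sup_{t\in[a,T]}|X_t|^2]<\infty$, and fix a continuous version of $t\mapsto\int_0^t\sigma(s)\,dW_s$ on $[0,T]$. For $x,y\in\mathbb R$ and $\theta\in[0,T]$ consider the solutions * $X^{\theta,y}\in\mathcal S^2_{\mathbb F}[\theta,T]$ of $X^{\theta,y}_t=y+\int_\theta^t b(s,X^{\theta,y}_s)\,ds+\int_\theta^t\sigma(s)\,dW_s$,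 $\theta\le t\le T$, and $X^{0}=X^{0,x}$ (that is, $\theta=0$, $y=x$); * $X^1(\theta)=X^{1,x}(\theta)\in\mathcal S^2_{\mathbb F}[0,T]$ of $X^1_t(\theta)=x+\int_0^t b(s,X^1_s(\theta))\,ds+\int_0^t\sigma(s)\,dW_s+\beta(\theta,X^1_{\theta^-}(\theta))\mathbf 1_{\theta\le t}$, $0\le t\le T$, where $X^1_{0^-}(0):=x$. For a family of processes indexed by an initial datum in $\mathbb R$, a continuous version is a family whose members are, for each value of the datum, indistinguishable from the given ones and which almost surely is, for every $t$, continuous in the datum. For a function $F:\mathbb R\to\mathbb R$, "$|F'|\le C$" means that $F$ is Lipschitz with constant $C$, is differentiable almost everywhere, and satisfies $|F'|\le C$ at every point where $F'$ exists. Then the families $(X^{0,x})_x$ and, for every $\theta\in[0,T]$, $(X^{\theta,y})_y$ and $(X^{1,x}(\theta))_x$ have continuous versions, and for all continuous versions: 1. Almost surely, for all $t\in[0,T]$, $$|\nabla X^0_t|:=\Big|\frac{\partial X^{0,x}_t}{\partial x}\Big|\le e^{L_aT}.$$ 2. For every $\theta\in[0,T]$, almost surely, for all $t\in[\theta,T]$: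 $X^1_t(\theta)=X^{\theta,y}_t$ with $y=X^1_\theta(\theta)$, and $$|\nabla^\theta X^1_t(\theta)|:=\Big|\frac{\partial X^1_t(\theta)}{\partial X^1_\theta(\theta)}\Big|\le e^{L_aT},$$ where the derivative is that of $y\mapsto X^{\theta,y}_t$ (and the bound holds for this function of $y\in\mathbb R$). 3. For every $\theta\in[0,T]$, almost surely, for all $t\in[\theta,T]$, $$|\nabla X^1_t(\theta)|:=\Big|\frac{\partial X^{1,x}_t(\theta)}{\partial x}\Big|\le(1+L_ae^{L_aT})e^{L_aT}.$$ If moreover $b(s,\cdot)$ is differentiable for every $s\in[0,T]$ (and, for 3, $\beta(\theta,\cdot)$ is differentiable), then these functions of the initial datum are differentiable everywhere. -/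

import Mathlib

open MeasureTheory ProbabilityTheory Filter Set
open scoped NNReal ENNReal Topology

/-- The natural filtration of a Brownian motion `W` on a complete probability space, augmented by
all the `P`-null sets. -/
def augmentedFiltration {Ω : Type*} [mΩ : MeasurableSpace Ω] (P : Measure Ω) [P.IsComplete]
    (W : ℝ≥0 → Ω → ℝ) (hW : IsBrownianReal W P) : Filtration ℝ≥0 mΩ where
  seq t := (⨆ s ≤ t, MeasurableSpace.comap (W s) inferInstance) ⊔
    MeasurableSpace.generateFrom {A : Set Ω | P A = 0}
  mono' _ _ hst := sup_le_sup_right (biSup_mono fun _ hr => hr.trans hst) _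
  le' t := by
    refine sup_le (iSup₂_le fun s _ => ?_) (MeasurableSpace.generateFrom_le fun A hA => ?_)
    · have h := hW.toIsPreBrownianReal.aemeasurable s
      exact (h.nullMeasurable.measurable_of_complete).comap_le
    · exact Measure.IsComplete.out' A hA

/-- A deterministic step function `∑_{i < n} coef i · 1_{(node i, node (i+1)]}` on `ℝ₊`. -/
structure StepFunction where
  n : ℕ
  node : ℕ → ℝ≥0
  mono : Monotone node
  coef : ℕ → ℝ

/-- The value of a step function at time `s`. -/
noncomputable def StepFunction.eval (φ : StepFunction) (s : ℝ) : ℝ :=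
  ∑ i ∈ Finset.range φ.n,
    (Ioc (φ.node i : ℝ) (φ.node (i + 1) : ℝ)).indicator (fun _ => φ.coef i) s

/-- The elementary integral `∫_0^t φ dW` of a step function. -/
noncomputable def StepFunction.integral {Ω : Type*} (φ : StepFunction) (W : ℝ≥0 → Ω → ℝ)
    (t : ℝ≥0) (ω : Ω) : ℝ :=
  ∑ i ∈ Finset.range φ.n, φ.coef i * (W (min (φ.node (i + 1)) t) ω - W (min (φ.node i) t) ω)

/-- `I` is a continuous version on `[0,T]` of the stochastic integral `(∫_0^t σ(s) dW_s)_t` of the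
deterministic function `σ`: almost all paths are continuous, and each `I t` is the limit in
`L²(P)` of the elementary integrals of step functions which converge to `σ` in `L²([0,t])`. -/
structure IsWienerIntegral {Ω : Type*} [MeasurableSpace Ω] (P : Measure Ω) (W : ℝ≥0 → Ω → ℝ)
    (T : ℝ) (σ : ℝ → ℝ) (I : ℝ → Ω → ℝ) : Prop where
  aemeasurable : ∀ t ∈ Icc 0 T, AEMeasurable (I t) P
  continuous : ∀ᵐ ω ∂P, ContinuousOn (fun t => I t ω) (Icc 0 T)
  limit : ∀ t ∈ Icc 0 T, ∃ φ : ℕ → StepFunction,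
    Tendsto (fun k => ∫⁻ s in Icc 0 t, ‖(φ k).eval s - σ s‖ₑ ^ 2) atTop (𝓝 0) ∧
    Tendsto (fun k => ∫⁻ ω, ‖(φ k).integral W t.toNNReal ω - I t ω‖ₑ ^ 2 ∂P) atTop (𝓝 0)

/-- The space `S²[a,c]` of the processes `(X_t)_{t ∈ [a,c]}` which are progressively measurable and
satisfy `E[sup_{t ∈ [a,c]} |X_t|²] < ∞`. Values of `X` at times outside `[a,c]` play no role. -/
structure MemS2 {Ω : Type*} [mΩ : MeasurableSpace Ω] (P : Measure Ω) (ℱ : Filtration ℝ≥0 mΩ)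
    (a c : ℝ) (X : ℝ → Ω → ℝ) : Prop where
  progressive : ∀ t : ℝ≥0, (t : ℝ) ∈ Icc a c →
    Measurable[Subtype.instMeasurableSpace.prod (ℱ t)]
      (fun p : Icc a (t : ℝ) × Ω => X p.1 p.2)
  sq_integrable : ∫⁻ ω, ⨆ t ∈ Icc a c, ‖X t ω‖ₑ ^ 2 ∂P < ∞

/-- The standing assumption on the forward coefficients, with constants `K` and `L`. -/
structure ForwardAssumption (T : ℝ) (b : ℝ → ℝ → ℝ) (σ : ℝ → ℝ) (β : ℝ → ℝ → ℝ) (K L : ℝ) :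
    Prop where
  bound : ∀ t ∈ Icc 0 T, |b t 0| + |σ t| + |β t 0| ≤ K
  lipschitz : ∀ t ∈ Icc 0 T, ∀ x x' : ℝ, |b t x - b t x'| + |β t x - β t x'| ≤ L * |x - x'|

/-- `X ∈ S²[θ,T]` solves `X_t = y + ∫_θ^t b(s, X_s) ds + ∫_θ^t σ(s) dW_s`, `θ ≤ t ≤ T`, where
`∫_θ^t σ(s) dW_s = I_t - I_θ`. The process `X⁰` started from `x` is the case `θ = 0`, `y = x`. -/
structure IsForwardSolution {Ω : Type*} [mΩ : MeasurableSpace Ω] (P : Measure Ω)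
    (ℱ : Filtration ℝ≥0 mΩ) (T : ℝ) (b : ℝ → ℝ → ℝ) (I : ℝ → Ω → ℝ) (θ y : ℝ)
    (X : ℝ → Ω → ℝ) : Prop where
  memS2 : MemS2 P ℱ θ T X
  drift : ∀ᵐ ω ∂P, IntervalIntegrable (fun s => b s (X s ω)) volume θ T
  eq : ∀ᵐ ω ∂P, ∀ t ∈ Icc θ T, X t ω = y + (∫ s in θ..t, b s (X s ω)) + (I t ω - I θ ω)

/-- The left limit at time `θ` of a path started from `x`, with the convention that the value
just before time `0` is the initial value `x`. -/
noncomputable def leftValue (x θ : ℝ) (f : ℝ → ℝ) : ℝ :=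
  if θ = 0 then x else Function.leftLim f θ

/-- `X ∈ S²[0,T]` solves, for `0 ≤ t ≤ T`,
`X_t = x + ∫_0^t b(s, X_s) ds + ∫_0^t σ(s) dW_s + β(θ, X_{θ-}) 1_{θ ≤ t}`, where
`∫_0^t σ(s) dW_s = I_t`. This is the process `X¹(θ)` started from `x`. -/
structure IsJumpSolution {Ω : Type*} [mΩ : MeasurableSpace Ω] (P : Measure Ω)
    (ℱ : Filtration ℝ≥0 mΩ) (T : ℝ) (b β : ℝ → ℝ → ℝ) (I : ℝ → Ω → ℝ) (θ x : ℝ)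
    (X : ℝ → Ω → ℝ) : Prop where
  memS2 : MemS2 P ℱ 0 T X
  drift : ∀ᵐ ω ∂P, IntervalIntegrable (fun s => b s (X s ω)) volume 0 T
  eq : ∀ᵐ ω ∂P, ∀ t ∈ Icc 0 T, X t ω = x + (∫ s in (0 : ℝ)..t, b s (X s ω)) + I t ω +
    (Ici θ).indicator (fun _ => β θ (leftValue x θ (fun s => X s ω))) t

/-- `Y` is a version on `[a,c]` of the family of processes `(X x)`, indexed by the initial
datum `x`, which depends continuously on the initial datum: for each `x` the processes `X x` and
`Y x` are indistinguishable on `[a,c]`, and almost surely all the maps `x ↦ Y x t ω` are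
continuous. (For an arbitrary choice of `X x` in its class of indistinguishable processes, chosen
separately for each `x`, a derivative with respect to `x` has no meaning.) -/
structure IsContinuousVersion {Ω : Type*} [MeasurableSpace Ω] (P : Measure Ω) (a c : ℝ)
    (X Y : ℝ → ℝ → Ω → ℝ) : Prop where
  version : ∀ x, ∀ᵐ ω ∂P, ∀ t ∈ Icc a c, Y x t ω = X x t ω
  continuous : ∀ᵐ ω ∂P, ∀ t ∈ Icc a c, Continuous (fun x => Y x t ω)

/-- The derivative of `F` is bounded by `C`, for a function `F` that need not be differentiable
everywhere: `F` is Lipschitz with constant `C`, it is differentiable almost everywhere, and its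
derivative is bounded by `C` at every point where it exists. -/
structure DerivativeBounded (F : ℝ → ℝ) (C : ℝ) : Prop where
  lipschitz : ∀ x x' : ℝ, |F x - F x'| ≤ C * |x - x'|
  ae_differentiable : ∀ᵐ x : ℝ, DifferentiableAt ℝ F x
  bound : ∀ x F' : ℝ, HasDerivAt F F' x → |F'| ≤ C

/-! The noise is additive, so it cancels in the difference `D` of two solutions. Path by path `D`
solves `D' = α D`, where `α` is the slope of `b(s, ·)` between the two solutions and `|α| ≤ L`.
Hence `D` is its initial value times `exp (∫ α)` (`IsPath.sub_eq`). This one identity gives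
uniqueness, the Lipschitz constant `exp (L T)` and, by dominated convergence as the slopes tend to
derivatives of `b`, differentiability in the datum. A jump path is the flow up to `θ`, the map `z ↦
z + γ z`, and the flow after `θ`, so its bounds and derivatives come by composition.

Each equation holds only off a null set depending on the datum. `continuousVersion_of_pathwise`
removes this dependence: all rational data share one null set, the Lipschitz bound extends the
family to real data, and the equation survives pointwise limits. Off one null set, every member of a
continuous version is thus a genuine solution. The derivative bounds are then Rademacher's theorem
for Lipschitz functions. -/

/-- The solution of a scalar linear integral equation with bounded measurable coefficient. -/
theorem eq_mul_exp_of_linear_integral_eq {a c h L : ℝ} (hac : a ≤ c) {α D : ℝ → ℝ}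
    (hα : IntervalIntegrable α volume a c) (hαL : ∀ s ∈ Icc a c, |α s| ≤ L)
    (hαD : IntervalIntegrable (fun s => α s * D s) volume a c)
    (hD : ∀ t ∈ Icc a c, D t = h + ∫ s in a..t, α s * D s) :
    ∀ t ∈ Icc a c, D t = h * Real.exp (∫ s in a..t, α s) := by
  set A : ℝ → ℝ := fun t => ∫ s in a..t, α s with hA
  set E : ℝ → ℝ := fun t => h + ∫ s in a..t, α s * D s with hE
  have huI : uIcc a c = Icc a c := uIcc_of_le hac
  have hL0 : 0 ≤ L := (abs_nonneg _).trans (hαL a ⟨le_rfl, hac⟩)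
  have hAlip : LipschitzOnWith L.toNNReal A (Icc a c) := by
    refine LipschitzOnWith.of_dist_le_mul fun x hx y hy => ?_
    rw [Real.dist_eq, Real.dist_eq, Real.coe_toNNReal _ hL0, hA]
    have hsub : ∀ z ∈ Icc a c, IntervalIntegrable α volume a z := fun z hz =>
      hα.mono_set (by rw [huI, uIcc_of_le hz.1]; exact Icc_subset_Icc_right hz.2)
    rw [intervalIntegral.integral_interval_sub_left (hsub x hx) (hsub y hy)]
    refine intervalIntegral.norm_integral_le_of_norm_le_const (f := α) (C := L) (fun s hs => hαL s ?_)
    have := uIoc_subset_uIcc hs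
    rw [mem_uIcc] at this
    rcases this with h1 | h1
    · exact ⟨hy.1.trans h1.1, h1.2.trans hx.2⟩
    · exact ⟨hx.1.trans h1.1, h1.2.trans hy.2⟩
  obtain ⟨M, hM⟩ := isCompact_Icc.exists_bound_of_continuousOn hAlip.continuousOn
  obtain ⟨C, hC⟩ := (Real.contDiff_exp (n := 1)).contDiffOn.exists_lipschitzOnWith one_ne_zero
    (convex_Icc (-M) M) isCompact_Icc
  have hexp : AbsolutelyContinuousOnInterval (fun t => Real.exp (-A t)) a c := by
    have h1 : LipschitzOnWith L.toNNReal (fun t => -A t) (Icc a c) := hAlip.neg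
    have h2 := hC.comp h1 (fun t ht => by
      have := hM t ht
      rw [Real.norm_eq_abs, abs_le] at this
      exact ⟨by linarith [this.2], by linarith [this.1]⟩)
    rw [← huI] at h2
    exact h2.absolutelyContinuousOnInterval
  have hEac : AbsolutelyContinuousOnInterval E a c := by
    have h1 : LipschitzOnWith 0 (fun _ : ℝ => h) (uIcc a c) :=
      (LipschitzWith.const h).lipschitzOnWith
    exact h1.absolutelyContinuousOnInterval.add
      (hαD.absolutelyContinuousOnInterval_intervalIntegral left_mem_uIcc)
  -- Integrating factor: `E * exp (-A)` has zero derivative almost everywhere, and absolute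
  -- continuity makes it constant. `E` replaces `D`, whose equation is known only on `[a, c]`.
  obtain ⟨k, hk⟩ := (hEac.fun_mul hexp).const_of_ae_hasDerivAt_zero (by
    filter_upwards [hα.ae_hasDerivAt_integral, hαD.ae_hasDerivAt_integral] with t h1 h2 ht
    have h1' := ((h1 ht a left_mem_uIcc).neg).exp
    have h2' := (h2 ht a left_mem_uIcc).const_add h
    have h3 := h2'.mul h1'
    refine h3.congr_deriv ?_
    rw [← hD t (huI ▸ ht)]
    ring)
  have hka : k = h := by
    rw [← hk a left_mem_uIcc]; simp [hE, hA]
  intro t ht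
  have h1 := hk t (huI ▸ ht)
  rw [hka] at h1
  simp only [hE] at h1
  rw [← hD t ht] at h1
  change D t = h * Real.exp (A t)
  rw [← h1, mul_assoc, ← Real.exp_add, neg_add_cancel, Real.exp_zero, mul_one]

/-! ### Deterministic paths without jump. -/

/-- `f` solves `f t = x + ∫_a^t b(s, f s) ds + g t` on `[a,c]`. -/
structure IsPath (b : ℝ → ℝ → ℝ) (g : ℝ → ℝ) (a c x : ℝ) (f : ℝ → ℝ) : Prop where
  integrable : IntervalIntegrable (fun s => b s (f s)) volume a c
  eq : ∀ t ∈ Icc a c, f t = x + (∫ s in a..t, b s (f s)) + g t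

theorem IntervalIntegrable.mono_Icc {u : ℝ → ℝ} {a c a' c' : ℝ}
    (h : IntervalIntegrable u volume a c) (h1 : a ≤ a') (h2 : a' ≤ c') (h3 : c' ≤ c) :
    IntervalIntegrable u volume a' c' :=
  h.mono_set (by
    rw [uIcc_of_le h2, uIcc_of_le (h1.trans (h2.trans h3))]; exact Icc_subset_Icc h1 h3)

theorem abs_slope_le_of_lipschitz {φ : ℝ → ℝ} {L : ℝ} (hL : 0 ≤ L)
    (hφ : ∀ x x', |φ x - φ x'| ≤ L * |x - x'|) (x y : ℝ) : |slope φ x y| ≤ L := by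
  rw [slope_def_field, abs_div]
  exact div_le_of_le_mul₀ (abs_nonneg _) hL (hφ _ _)

namespace IsPath

variable {b : ℝ → ℝ → ℝ} {g : ℝ → ℝ} {a c x x' L : ℝ} {f f' : ℝ → ℝ}

/-- The rough term `g` cancels, so only primitives of integrable functions remain. -/
theorem continuousOn_sub (hac : a ≤ c) (hf : IsPath b g a c x f) (hf' : IsPath b g a c x' f') :
    ContinuousOn (fun t => f' t - f t) (Icc a c) := by
  have h1 := intervalIntegral.continuousOn_primitive_interval' hf.integrable left_mem_uIcc
  have h2 := intervalIntegral.continuousOn_primitive_interval' hf'.integrable left_mem_uIcc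
  rw [uIcc_of_le hac] at h1 h2
  refine (((h2.sub h1).const_add (x' - x)) : ContinuousOn _ _).congr fun t ht => ?_
  rw [hf.eq t ht, hf'.eq t ht]
  simp only [Pi.sub_apply]
  ring

/-- The slope is a quotient of the difference of the integrable drifts by a continuous function;
where the paths meet it is `0` by convention, which respects the bound `L`. -/
theorem intervalIntegrable_slope (hac : a ≤ c)
    (hb : ∀ t ∈ Icc a c, ∀ y y' : ℝ, |b t y - b t y'| ≤ L * |y - y'|) (hL : 0 ≤ L)
    (hf : IsPath b g a c x f) (hf' : IsPath b g a c x' f') :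
    IntervalIntegrable (fun s => slope (b s) (f s) (f' s)) volume a c := by
  have hm : AEStronglyMeasurable (fun s => slope (b s) (f s) (f' s))
      (volume.restrict (Ioc a c)) := by
    have h1 := ((intervalIntegrable_iff_integrableOn_Ioc_of_le hac).1
      (hf'.integrable.sub hf.integrable)).aestronglyMeasurable
    have h2 := ((hf.continuousOn_sub hac hf').mono Ioc_subset_Icc_self).aestronglyMeasurable
      (μ := volume) measurableSet_Ioc
    simp_rw [slope_def_field]
    exact h1.aemeasurable.div h2.aemeasurable |>.aestronglyMeasurable
  rw [intervalIntegrable_iff_integrableOn_Ioc_of_le hac]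
  refine Integrable.mono' (g := fun _ => L) (by simp) hm ?_
  filter_upwards [ae_restrict_mem measurableSet_Ioc] with s hs
  exact abs_slope_le_of_lipschitz hL (hb s (Ioc_subset_Icc_self hs)) _ _

/-- The difference of two solutions is the difference of the initial values, multiplied by the
exponential of the integrated slopes of the drift. -/
theorem sub_eq (hac : a ≤ c)
    (hb : ∀ t ∈ Icc a c, ∀ y y' : ℝ, |b t y - b t y'| ≤ L * |y - y'|) (hL : 0 ≤ L)
    (hf : IsPath b g a c x f) (hf' : IsPath b g a c x' f') {t : ℝ} (ht : t ∈ Icc a c) :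
    f' t - f t = (x' - x) * Real.exp (∫ s in a..t, slope (b s) (f s) (f' s)) := by
  have key : ∀ s, slope (b s) (f s) (f' s) * (f' s - f s) = b s (f' s) - b s (f s) := fun s => by
    rw [mul_comm]; exact sub_smul_slope (b s) (f s) (f' s)
  refine eq_mul_exp_of_linear_integral_eq (D := fun t => f' t - f t) hac
    (hf.intervalIntegrable_slope hac hb hL hf')
    (fun s hs => abs_slope_le_of_lipschitz hL (hb s hs) _ _) ?_ (fun r hr => ?_) t ht
  · simp_rw [key]
    exact hf'.integrable.sub hf.integrable
  · simp_rw [key]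
    rw [intervalIntegral.integral_sub (hf'.integrable.mono_Icc le_rfl hr.1 hr.2)
      (hf.integrable.mono_Icc le_rfl hr.1 hr.2), hf.eq r hr, hf'.eq r hr]
    ring

theorem abs_sub_le (hac : a ≤ c)
    (hb : ∀ t ∈ Icc a c, ∀ y y' : ℝ, |b t y - b t y'| ≤ L * |y - y'|) (hL : 0 ≤ L)
    (hf : IsPath b g a c x f) (hf' : IsPath b g a c x' f') {t : ℝ} (ht : t ∈ Icc a c) :
    |f' t - f t| ≤ Real.exp (L * (t - a)) * |x' - x| := by
  rw [hf.sub_eq hac hb hL hf' ht, abs_mul, abs_of_pos (Real.exp_pos _), mul_comm]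
  refine mul_le_mul_of_nonneg_right (Real.exp_le_exp.2 ?_) (abs_nonneg _)
  have := intervalIntegral.norm_integral_le_of_norm_le_const (a := a) (b := t) (C := L)
    (f := fun s => slope (b s) (f s) (f' s)) (fun s hs => by
      rw [uIoc_of_le ht.1] at hs
      exact abs_slope_le_of_lipschitz hL (hb s ⟨hs.1.le, hs.2.trans ht.2⟩) _ _)
  rw [abs_of_nonneg (sub_nonneg.2 ht.1)] at this
  exact (le_abs_self _).trans this

/-- Solutions depend differentiably on a parameter, if their initial values do. -/
theorem differentiableAt_param (hac : a ≤ c)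
    (hb : ∀ t ∈ Icc a c, ∀ y y' : ℝ, |b t y - b t y'| ≤ L * |y - y'|) (hL : 0 ≤ L)
    (hdiff : ∀ t ∈ Icc a c, Differentiable ℝ (b t)) {u : ℝ → ℝ} {F : ℝ → ℝ → ℝ}
    (hF : ∀ z, IsPath b g a c (u z) (F z)) {z : ℝ} (hu : DifferentiableAt ℝ u z)
    {t : ℝ} (ht : t ∈ Icc a c) : DifferentiableAt ℝ (fun w => F w t) z := by
  set e : ℝ := Real.exp (∫ s in a..t, deriv (b s) (F z s)) with he
  set E : ℝ → ℝ := fun w => Real.exp (∫ s in a..t, slope (b s) (F z s) (F w s)) with hE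
  have hcont : ∀ s ∈ Icc a c, Tendsto (fun w => F w s) (𝓝 z) (𝓝 (F z s)) := fun s hs => by
    rw [tendsto_iff_dist_tendsto_zero]
    refine squeeze_zero (fun _ => dist_nonneg)
      (fun w => (hF z).abs_sub_le hac hb hL (hF w) hs) ?_
    have h1 : Tendsto (fun w => |u w - u z|) (𝓝 z) (𝓝 0) := by
      simpa [Real.dist_eq] using tendsto_iff_dist_tendsto_zero.1 hu.continuousAt.tendsto
    simpa using h1.const_mul (Real.exp (L * (s - a)))
  -- Slopes tend to the derivative of `b s` only along values different from `F z s`. By `sub_eq`,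
  -- `u w ≠ u z` keeps the two paths apart at every time, the exponential being nonzero.
  have hEt : Tendsto E (𝓝[≠] z ⊓ 𝓟 {w | ¬ u w = u z}) (𝓝 e) := by
    refine (Real.continuous_exp.tendsto _).comp ?_
    refine intervalIntegral.tendsto_integral_filter_of_dominated_convergence (fun _ => L)
      (Eventually.of_forall fun w => ?_) (Eventually.of_forall fun w => ?_) (by simp) ?_
    · have := ((hF z).intervalIntegrable_slope hac hb hL (hF w)).mono_Icc le_rfl ht.1 ht.2
      rw [uIoc_of_le ht.1]
      exact ((intervalIntegrable_iff_integrableOn_Ioc_of_le ht.1).1 this).aestronglyMeasurable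
    · refine Eventually.of_forall fun s hs => ?_
      rw [uIoc_of_le ht.1] at hs
      exact abs_slope_le_of_lipschitz hL (hb s ⟨hs.1.le, hs.2.trans ht.2⟩) _ _
    · refine Eventually.of_forall fun s hs => ?_
      rw [uIoc_of_le ht.1] at hs
      have hs' : s ∈ Icc a c := ⟨hs.1.le, hs.2.trans ht.2⟩
      refine (hasDerivAt_iff_tendsto_slope.1 (hdiff s hs' (F z s)).hasDerivAt).comp ?_
      refine tendsto_nhdsWithin_iff.2
        ⟨(hcont s hs').mono_left (inf_le_left.trans nhdsWithin_le_nhds), ?_⟩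
      refine eventually_inf_principal.2 (Eventually.of_forall fun w hw => ?_)
      have h1 := (hF z).sub_eq hac hb hL (hF w) hs'
      intro h2
      rw [mem_singleton_iff.1 h2, sub_self] at h1
      exact (mul_ne_zero (sub_ne_zero.2 hw) (Real.exp_pos _).ne') h1.symm
  classical
  -- Where `u w = u z` the paths coincide and the slope of `u` vanishes, so the second factor may be
  -- set to its limit `e` there.
  have hE' : Tendsto (fun w => if u w = u z then e else E w) (𝓝[≠] z) (𝓝 e) :=
    tendsto_const_nhds.if hEt
  refine HasDerivAt.differentiableAt (f' := deriv u z * e) ?_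
  rw [hasDerivAt_iff_tendsto_slope]
  refine ((hasDerivAt_iff_tendsto_slope.1 hu.hasDerivAt).mul hE').congr fun w => ?_
  have h1 := (hF z).sub_eq hac hb hL (hF w) ht
  rw [slope_def_field, slope_def_field, h1]
  split_ifs with h
  · simp [h]
  · simp only [hE]; ring

end IsPath

/-! ### Deterministic paths with one jump. -/

/-- `f` solves `f t = x + ∫_a^t b(s, f s) ds + g t + γ(f(θ-)) 1_{θ ≤ t}` on `[a,c]`, where the left
limit is expressed through the equation. -/
structure IsJumpPath (b : ℝ → ℝ → ℝ) (g γ : ℝ → ℝ) (a θ c x : ℝ) (f : ℝ → ℝ) : Prop where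
  integrable : IntervalIntegrable (fun s => b s (f s)) volume a c
  eq : ∀ t ∈ Icc a c, f t = x + (∫ s in a..t, b s (f s)) + g t +
    (Ici θ).indicator (fun _ => γ (x + (∫ s in a..θ, b s (f s)) + g θ)) t

/-- Lets the closedness result `IsJumpPath.of_tendsto` serve paths without jump too. -/
theorem isJumpPath_zero_iff {b : ℝ → ℝ → ℝ} {g : ℝ → ℝ} {a θ c x : ℝ} {f : ℝ → ℝ} :
    IsJumpPath b g 0 a θ c x f ↔ IsPath b g a c x f :=
  ⟨fun h => ⟨h.integrable, fun t ht => by simpa using h.eq t ht⟩,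
    fun h => ⟨h.integrable, fun t ht => by simpa using h.eq t ht⟩⟩

namespace IsJumpPath

variable {b : ℝ → ℝ → ℝ} {g γ : ℝ → ℝ} {a θ c x x' L : ℝ} {f f' : ℝ → ℝ}

/-- The continuous path which agrees with a jump path before the jump. -/
theorem isPath_before (hθ : θ ∈ Icc a c) (hf : IsJumpPath b g γ a θ c x f) :
    IsPath b g a θ x (fun t => x + (∫ s in a..t, b s (f s)) + g t) := by
  have hae : ∀ t ∈ Icc a θ, ∀ᵐ s, s ∈ uIoc a t →
      b s (f s) = b s (x + (∫ r in a..s, b r (f r)) + g s) := fun t ht => by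
    -- Up to `θ` the two paths can differ only at `s = θ`, where `f` already carries the jump.
    filter_upwards [Measure.ae_ne volume θ] with s hs hst
    rw [uIoc_of_le ht.1] at hst
    have hsθ : s < θ := lt_of_le_of_ne (hst.2.trans ht.2) hs
    have h1 := hf.eq s ⟨hst.1.le, hsθ.le.trans hθ.2⟩
    rw [indicator_of_notMem (by simpa using hsθ), add_zero] at h1
    rw [← h1]
  refine ⟨?_, fun t ht => ?_⟩
  · exact (hf.integrable.mono_Icc le_rfl hθ.1 hθ.2).congr_ae
      ((ae_restrict_iff' measurableSet_uIoc).2 (hae θ ⟨hθ.1, le_rfl⟩))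
  · simp only [add_left_inj, add_right_inj]
    exact intervalIntegral.integral_congr_ae (hae t ht)

/-- After the jump, a jump path is a continuous path. -/
theorem isPath_after (hθ : θ ∈ Icc a c) (hf : IsJumpPath b g γ a θ c x f) :
    IsPath b (fun t => g t - g θ) θ c (f θ) f := by
  refine ⟨hf.integrable.mono_Icc hθ.1 hθ.2 le_rfl, fun t ht => ?_⟩
  have ht' : t ∈ Icc a c := ⟨hθ.1.trans ht.1, ht.2⟩
  rw [hf.eq t ht', hf.eq θ hθ, indicator_of_mem (by simpa using ht.1),
    indicator_of_mem (by simp), ← intervalIntegral.integral_add_adjacent_intervals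
      (hf.integrable.mono_Icc le_rfl hθ.1 hθ.2) (hf.integrable.mono_Icc hθ.1 ht.1 ht.2)]
  ring

theorem apply_jump (hθ : θ ∈ Icc a c) (hf : IsJumpPath b g γ a θ c x f) :
    f θ = x + (∫ s in a..θ, b s (f s)) + g θ + γ (x + (∫ s in a..θ, b s (f s)) + g θ) := by
  have := hf.eq θ hθ
  rwa [indicator_of_mem (by simp)] at this

/-- The factors multiply: the flow before `θ`, then `1 + L` for `z ↦ z + γ z`, then the flow after
`θ`. -/
theorem abs_sub_le (hθ : θ ∈ Icc a c)
    (hb : ∀ t ∈ Icc a c, ∀ y y' : ℝ, |b t y - b t y'| ≤ L * |y - y'|) (hL : 0 ≤ L)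
    (hγ : ∀ y y' : ℝ, |γ y - γ y'| ≤ L * |y - y'|)
    (hf : IsJumpPath b g γ a θ c x f) (hf' : IsJumpPath b g γ a θ c x' f') {t : ℝ}
    (ht : t ∈ Icc a c) : |f' t - f t| ≤ (1 + L) * Real.exp (L * (t - a)) * |x' - x| := by
  have hbef : ∀ r ∈ Icc a θ, _ := fun r hr => (hf.isPath_before hθ).abs_sub_le hθ.1
    (fun s hs => hb s ⟨hs.1, hs.2.trans hθ.2⟩) hL (hf'.isPath_before hθ) hr
  rcases lt_or_ge t θ with h | h
  · have h1 := hbef t ⟨ht.1, h.le⟩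
    have e1 := hf.eq t ht
    have e2 := hf'.eq t ht
    rw [indicator_of_notMem (by simpa using h), add_zero] at e1 e2
    rw [← e1, ← e2] at h1
    refine h1.trans (mul_le_mul_of_nonneg_right ?_ (abs_nonneg _))
    exact le_mul_of_one_le_left (Real.exp_pos _).le (by linarith)
  · have h1 := hbef θ ⟨hθ.1, le_rfl⟩
    have h2 := (hf.isPath_after hθ).abs_sub_le hθ.2
      (fun s hs => hb s ⟨hθ.1.trans hs.1, hs.2⟩) hL (hf'.isPath_after hθ) ⟨h, ht.2⟩
    set z := x + (∫ s in a..θ, b s (f s)) + g θ with hz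
    set z' := x' + (∫ s in a..θ, b s (f' s)) + g θ with hz'
    have h3 : |f' θ - f θ| ≤ (1 + L) * |z' - z| := by
      rw [hf.apply_jump hθ, hf'.apply_jump hθ, ← hz, ← hz']
      calc |z' + γ z' - (z + γ z)| = |(z' - z) + (γ z' - γ z)| := by congr 1; ring
        _ ≤ |z' - z| + |γ z' - γ z| := abs_add_le _ _
        _ ≤ (1 + L) * |z' - z| := by linarith [hγ z' z]
    calc |f' t - f t| ≤ Real.exp (L * (t - θ)) * |f' θ - f θ| := h2
      _ ≤ Real.exp (L * (t - θ)) * ((1 + L) * (Real.exp (L * (θ - a)) * |x' - x|)) := by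
          gcongr
          exact h3.trans (by gcongr)
      _ = (1 + L) * Real.exp (L * (t - a)) * |x' - x| := by
          rw [show L * (t - a) = L * (t - θ) + L * (θ - a) by ring, Real.exp_add]; ring

theorem differentiable_param (hθ : θ ∈ Icc a c)
    (hb : ∀ t ∈ Icc a c, ∀ y y' : ℝ, |b t y - b t y'| ≤ L * |y - y'|) (hL : 0 ≤ L)
    (hdiff : ∀ t ∈ Icc a c, Differentiable ℝ (b t)) (hγ : Differentiable ℝ γ)
    {F : ℝ → ℝ → ℝ} (hF : ∀ z, IsJumpPath b g γ a θ c z (F z))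
    {t : ℝ} (ht : t ∈ Icc θ c) : Differentiable ℝ (fun w => F w t) := fun z => by
  have h1 := IsPath.differentiableAt_param hθ.1 (fun s hs => hb s ⟨hs.1, hs.2.trans hθ.2⟩) hL
    (fun s hs => hdiff s ⟨hs.1, hs.2.trans hθ.2⟩) (u := id) (z := z)
    (fun w => (hF w).isPath_before hθ) differentiableAt_id (right_mem_Icc.2 hθ.1)
  refine IsPath.differentiableAt_param hθ.2 (fun s hs => hb s ⟨hθ.1.trans hs.1, hs.2⟩) hL
    (fun s hs => hdiff s ⟨hθ.1.trans hs.1, hs.2⟩) (fun w => (hF w).isPath_after hθ) ?_ ht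
  simp_rw [fun w => (hF w).apply_jump hθ]
  exact h1.add ((hγ _).comp z h1)

/-- Dominated convergence in the equation: the Lipschitz estimate keeps all `F n` within a fixed
distance `M` of `F 0`, so `|b t (F 0 t)| + L * M` dominates the drifts. -/
theorem of_tendsto (hθ : θ ∈ Icc a c)
    (hb : ∀ t ∈ Icc a c, ∀ y y' : ℝ, |b t y - b t y'| ≤ L * |y - y'|) (hL : 0 ≤ L)
    (hγ : ∀ y y' : ℝ, |γ y - γ y'| ≤ L * |y - y'|)
    {u : ℕ → ℝ} {F : ℕ → ℝ → ℝ} (hF : ∀ n, IsJumpPath b g γ a θ c (u n) (F n))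
    (hu : Tendsto u atTop (𝓝 x)) (hFf : ∀ t ∈ Icc a c, Tendsto (fun n => F n t) atTop (𝓝 (f t))) :
    IsJumpPath b g γ a θ c x f := by
  have hac : a ≤ c := hθ.1.trans hθ.2
  have hcont : ∀ {φ : ℝ → ℝ}, (∀ y y' : ℝ, |φ y - φ y'| ≤ L * |y - y'|) → Continuous φ :=
    fun {φ} h => (LipschitzWith.of_dist_le_mul (K := L.toNNReal) fun y y' => by
      rw [Real.coe_toNNReal _ hL]; exact h y y').continuous
  obtain ⟨B, hB⟩ : ∃ B, ∀ n, |u n - u 0| ≤ B := by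
    obtain ⟨B, hB⟩ := (hu.sub_const (u 0)).abs.bddAbove_range
    exact ⟨B, fun n => hB ⟨n, rfl⟩⟩
  set M := (1 + L) * Real.exp (L * (c - a)) * B with hM
  have hFM : ∀ n, ∀ t ∈ Icc a c, |F n t - F 0 t| ≤ M := fun n t ht =>
    ((hF 0).abs_sub_le hθ hb hL hγ (hF n) ht).trans (by
      have := ht.2
      have := hB n
      rw [hM]
      gcongr)
  have hlim : ∀ t ∈ Icc a c, Tendsto (fun n => b t (F n t)) atTop (𝓝 (b t (f t))) := fun t ht =>
    ((hcont (hb t ht)).tendsto _).comp (hFf t ht)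
  have hdom : ∀ n, ∀ t ∈ Icc a c, ‖b t (F n t)‖ ≤ |b t (F 0 t)| + L * M := fun n t ht => by
    have h1 := (hb t ht (F n t) (F 0 t)).trans (mul_le_mul_of_nonneg_left (hFM n t ht) hL)
    have h2 := abs_sub_abs_le_abs_sub (b t (F n t)) (b t (F 0 t))
    rw [Real.norm_eq_abs]; linarith
  have hdomi : IntervalIntegrable (fun t => |b t (F 0 t)| + L * M) volume a c :=
    (hF 0).integrable.abs.add (by simp)
  have hmeas : ∀ n, AEStronglyMeasurable (fun s => b s (F n s)) (volume.restrict (Ioc a c)) :=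
    fun n => ((intervalIntegrable_iff_integrableOn_Ioc_of_le hac).1
      (hF n).integrable).aestronglyMeasurable
  have hint : ∀ t ∈ Icc a c, Tendsto (fun n => ∫ s in a..t, b s (F n s)) atTop
      (𝓝 (∫ s in a..t, b s (f s))) := fun t ht => by
    refine intervalIntegral.tendsto_integral_filter_of_dominated_convergence
      (fun t => |b t (F 0 t)| + L * M) (Eventually.of_forall fun n => ?_)
      (Eventually.of_forall fun n => Eventually.of_forall fun s hs => ?_)
      (hdomi.mono_Icc le_rfl ht.1 ht.2) (Eventually.of_forall fun s hs => ?_) <;>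
    rw [uIoc_of_le ht.1] at *
    · exact (hmeas n).mono_measure (Measure.restrict_mono (Ioc_subset_Ioc_right ht.2) le_rfl)
    · exact hdom n s ⟨hs.1.le, hs.2.trans ht.2⟩
    · exact hlim s ⟨hs.1.le, hs.2.trans ht.2⟩
  refine ⟨?_, fun t ht => ?_⟩
  · rw [intervalIntegrable_iff_integrableOn_Ioc_of_le hac] at hdomi ⊢
    refine Integrable.mono' hdomi (aestronglyMeasurable_of_tendsto_ae atTop hmeas ?_) ?_ <;>
    filter_upwards [ae_restrict_mem measurableSet_Ioc] with s hs
    · exact hlim s (Ioc_subset_Icc_self hs)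
    · exact le_of_tendsto (hlim s (Ioc_subset_Icc_self hs)).norm
        (Eventually.of_forall fun n => hdom n s (Ioc_subset_Icc_self hs))
  · refine tendsto_nhds_unique (hFf t ht) ?_
    simp_rw [fun n => (hF n).eq t ht]
    refine ((hu.add (hint t ht)).add_const _).add ?_
    by_cases h : t ∈ Ici θ
    · simp only [indicator_of_mem h]
      exact ((hcont hγ).tendsto _).comp ((hu.add (hint θ hθ)).add_const _)
    · simp only [indicator_of_notMem h]
      exact tendsto_const_nhds

end IsJumpPath

/-! ### From pathwise properties to continuous versions. -/

theorem exists_seq_rat_tendsto (x : ℝ) :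
    ∃ q : ℕ → ℚ, Tendsto (fun n => (q n : ℝ)) atTop (𝓝 x) := by
  obtain ⟨v, hv, hvx⟩ := mem_closure_iff_seq_limit.1 (Rat.denseRange_cast (𝕜 := ℝ) x)
  choose q hq using hv
  exact ⟨q, by simpa [hq] using hvx⟩

/-- A family of processes, each of which almost surely satisfies a pathwise property that is closed
under pointwise limits and forces Lipschitz dependence on the initial datum, has a continuous
version, and almost surely all members of any continuous version have the property. -/
theorem continuousVersion_of_pathwise {Ω : Type*} [MeasurableSpace Ω] {P : Measure Ω} {a c C : ℝ}
    {S : Ω → ℝ → (ℝ → ℝ) → Prop} (hC : 0 ≤ C)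
    (hlip : ∀ ω x x' f f', S ω x f → S ω x' f' → ∀ t ∈ Icc a c, |f' t - f t| ≤ C * |x' - x|)
    (hclosed : ∀ ω (u : ℕ → ℝ) (F : ℕ → ℝ → ℝ) x f, (∀ n, S ω (u n) (F n)) →
      Tendsto u atTop (𝓝 x) → (∀ t ∈ Icc a c, Tendsto (fun n => F n t) atTop (𝓝 (f t))) → S ω x f)
    {X : ℝ → ℝ → Ω → ℝ} (hX : ∀ x, ∀ᵐ ω ∂P, S ω x (fun t => X x t ω)) :
    (∃ Y, IsContinuousVersion P a c X Y) ∧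
    ∀ Y, IsContinuousVersion P a c X Y → ∀ᵐ ω ∂P, ∀ x, S ω x (fun t => Y x t ω) := by
  have hXq : ∀ᵐ ω ∂P, ∀ q : ℚ, S ω q (fun t => X q t ω) := ae_all_iff.2 fun q => hX q
  refine ⟨?_, fun Y hY => ?_⟩
  -- The implication makes the choice of a Lipschitz extension possible for every `ω`; where the
  -- rational family is not Lipschitz, the value is irrelevant.
  · have hext : ∀ t ω, ∃ y : ℝ → ℝ,
        LipschitzOnWith C.toNNReal (fun x => X x t ω) (range ((↑) : ℚ → ℝ)) →
        LipschitzWith C.toNNReal y ∧ EqOn (fun x => X x t ω) y (range ((↑) : ℚ → ℝ)) :=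
      fun t ω => by
        by_cases h : LipschitzOnWith C.toNNReal (fun x => X x t ω) (range ((↑) : ℚ → ℝ))
        · obtain ⟨y, hy⟩ := h.extend_real
          exact ⟨y, fun _ => hy⟩
        · exact ⟨0, fun h' => (h h').elim⟩
    choose y hy using hext
    have hgood : ∀ ω, (∀ q : ℚ, S ω q (fun t => X q t ω)) → ∀ t ∈ Icc a c,
        LipschitzOnWith C.toNNReal (fun x => X x t ω) (range ((↑) : ℚ → ℝ)) :=
      fun ω hω t ht => by
        refine LipschitzOnWith.of_dist_le_mul ?_
        rintro _ ⟨p, rfl⟩ _ ⟨q, rfl⟩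
        rw [Real.coe_toNNReal _ hC]
        exact hlip ω _ _ _ _ (hω q) (hω p) t ht
    refine ⟨fun x t ω => y t ω x, fun x => ?_, ?_⟩
    -- Off the null set of this `x`, `X x` is itself within the Lipschitz bound of the rational
    -- members, hence equals their limit.
    · filter_upwards [hXq, hX x] with ω hω hx t ht
      obtain ⟨h1, h2⟩ := hy t ω (hgood ω hω t ht)
      obtain ⟨q, hq⟩ := exists_seq_rat_tendsto x
      refine tendsto_nhds_unique ((h1.continuous.tendsto x).comp hq) ?_
      have : Tendsto (fun n => X (q n) t ω) atTop (𝓝 (X x t ω)) := by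
        rw [tendsto_iff_dist_tendsto_zero]
        refine squeeze_zero (fun _ => dist_nonneg) (fun n => hlip ω _ _ _ _ hx (hω (q n)) t ht) ?_
        simpa [Real.dist_eq] using (tendsto_iff_dist_tendsto_zero.1 hq).const_mul C
      exact this.congr fun n => h2 ⟨q n, rfl⟩
    · filter_upwards [hXq] with ω hω t ht
      exact (hy t ω (hgood ω hω t ht)).1.continuous
  · have hv : ∀ᵐ ω ∂P, ∀ q : ℚ, ∀ t ∈ Icc a c, Y q t ω = X q t ω :=
      ae_all_iff.2 fun q => hY.version q
    filter_upwards [hXq, hv, hY.continuous] with ω h1 h2 h3 x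
    obtain ⟨q, hq⟩ := exists_seq_rat_tendsto x
    refine hclosed ω _ _ x _ (fun n => h1 (q n)) hq fun t ht => ?_
    exact (((h3 t ht).tendsto x).comp hq).congr fun n => h2 (q n) t ht

theorem derivativeBounded_of_lipschitz {F : ℝ → ℝ} {C : ℝ}
    (h : ∀ x x' : ℝ, |F x - F x'| ≤ C * |x - x'|) : DerivativeBounded F C := by
  have hC : 0 ≤ C := by simpa using (abs_nonneg _).trans (h 1 0)
  have hF : LipschitzWith C.toNNReal F := LipschitzWith.of_dist_le_mul fun x x' => by
    rw [Real.coe_toNNReal _ hC]; exact h x x'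
  refine ⟨h, hF.ae_differentiableAt_real, fun x F' hF' => ?_⟩
  simpa [Real.coe_toNNReal _ hC] using hF'.le_of_lipschitz hF

/-! ### The stochastic equations and their flows. -/

namespace ForwardAssumption

variable {T K L : ℝ} {b β : ℝ → ℝ → ℝ} {σ : ℝ → ℝ}

theorem lipschitz_drift (hF : ForwardAssumption T b σ β K L) :
    ∀ t ∈ Icc 0 T, ∀ x x' : ℝ, |b t x - b t x'| ≤ L * |x - x'| := fun t ht x x' => by
  linarith [hF.lipschitz t ht x x', abs_nonneg (β t x - β t x')]

theorem lipschitz_jump (hF : ForwardAssumption T b σ β K L) :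
    ∀ t ∈ Icc 0 T, ∀ x x' : ℝ, |β t x - β t x'| ≤ L * |x - x'| := fun t ht x x' => by
  linarith [hF.lipschitz t ht x x', abs_nonneg (b t x - b t x')]

theorem nonneg (hT : 0 ≤ T) (hF : ForwardAssumption T b σ β K L) : 0 ≤ L := by
  simpa using (abs_nonneg _).trans (hF.lipschitz_drift 0 ⟨le_rfl, hT⟩ 1 0)

end ForwardAssumption

/-- At time `0` every elementary integral vanishes, hence so does their `L²` limit. This matches the
convention for the left value when `θ = 0`. -/
theorem IsWienerIntegral.ae_zero {Ω : Type*} [MeasurableSpace Ω] {P : Measure Ω}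
    {W : ℝ≥0 → Ω → ℝ} {T : ℝ} (hT : 0 ≤ T) {σ : ℝ → ℝ} {I : ℝ → Ω → ℝ}
    (hI : IsWienerIntegral P W T σ I) : ∀ᵐ ω ∂P, I 0 ω = 0 := by
  have h0 : (0 : ℝ) ∈ Icc 0 T := ⟨le_rfl, hT⟩
  obtain ⟨φ, -, hφ⟩ := hI.limit 0 h0
  have h1 : ∀ k ω, (φ k).integral W (0 : ℝ).toNNReal ω = 0 := fun k ω => by
    simp [StepFunction.integral]
  simp_rw [h1] at hφ
  have h2 := tendsto_nhds_unique tendsto_const_nhds hφ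
  rw [lintegral_eq_zero_iff'
    (((hI.aemeasurable 0 h0).const_sub (0 : ℝ)).enorm.pow_const 2)] at h2
  filter_upwards [h2] with ω hω
  simpa using hω

section Solutions

variable {Ω : Type*} [mΩ : MeasurableSpace Ω] {P : Measure Ω} {ℱ : Filtration ℝ≥0 mΩ}
  {T K L θ : ℝ} {b β : ℝ → ℝ → ℝ} {σ : ℝ → ℝ} {I : ℝ → Ω → ℝ}

theorem IsForwardSolution.ae_isPath {y : ℝ} {X : ℝ → Ω → ℝ}
    (hX : IsForwardSolution P ℱ T b I θ y X) :
    ∀ᵐ ω ∂P, IsPath b (fun t => I t ω - I θ ω) θ T y (fun t => X t ω) := by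
  filter_upwards [hX.drift, hX.eq] with ω h1 h2
  exact ⟨h1, h2⟩

/-- Before `θ` the path is a primitive plus the continuous `I`, so its left limit is the right side
of the equation without the jump, a form stable under limits. -/
theorem IsJumpSolution.ae_isJumpPath (hθ : θ ∈ Icc 0 T)
    (hIcont : ∀ᵐ ω ∂P, ContinuousOn (fun t => I t ω) (Icc 0 T)) (hI0 : ∀ᵐ ω ∂P, I 0 ω = 0)
    {x : ℝ} {X : ℝ → Ω → ℝ} (hX : IsJumpSolution P ℱ T b β I θ x X) :
    ∀ᵐ ω ∂P, IsJumpPath b (fun t => I t ω) (β θ) 0 θ T x (fun t => X t ω) := by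
  filter_upwards [hX.drift, hX.eq, hIcont, hI0] with ω h1 h2 h3 h4
  suffices hleft : leftValue x θ (fun s => X s ω) =
      x + (∫ s in (0 : ℝ)..θ, b s (X s ω)) + I θ ω by
    rw [hleft] at h2
    exact ⟨h1, h2⟩
  unfold leftValue
  split_ifs with h
  · simp [h, h4]
  have hpos : 0 < θ := lt_of_le_of_ne hθ.1 (Ne.symm h)
  refine leftLim_eq_of_tendsto ?_
  have hprim := intervalIntegral.continuousOn_primitive_interval' h1 left_mem_uIcc
  rw [uIcc_of_le (hθ.1.trans hθ.2)] at hprim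
  have hcont : ContinuousOn (fun t => x + (∫ s in (0 : ℝ)..t, b s (X s ω)) + I t ω) (Icc 0 T) :=
    (continuousOn_const.add hprim).add h3
  have hnhds : Icc 0 T ∈ 𝓝[<] θ := mem_of_superset (Ioo_mem_nhdsLT hpos)
    fun s hs => ⟨hs.1.le, hs.2.le.trans hθ.2⟩
  refine ((hcont θ hθ).mono_left (le_inf nhdsWithin_le_nhds (le_principal_iff.2 hnhds))).congr' ?_
  filter_upwards [Ioo_mem_nhdsLT hpos] with s hs
  rw [h2 s ⟨hs.1.le, hs.2.le.trans hθ.2⟩, indicator_of_notMem (by simpa using hs.2), add_zero]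

/-- The flow of the equation without jump, started at time `θ`. -/
theorem forwardFlow (hF : ForwardAssumption T b σ β K L) (hθ : θ ∈ Icc 0 T)
    {Φ : ℝ → ℝ → Ω → ℝ} (hΦ : ∀ y, IsForwardSolution P ℱ T b I θ y (Φ y)) :
    (∃ Y, IsContinuousVersion P θ T Φ Y) ∧
    ∀ Y, IsContinuousVersion P θ T Φ Y → ∀ᵐ ω ∂P,
      (∀ y, IsPath b (fun t => I t ω - I θ ω) θ T y (fun t => Y y t ω)) ∧
      ∀ t ∈ Icc θ T, DerivativeBounded (fun y => Y y t ω) (Real.exp (L * T)) ∧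
        ((∀ s ∈ Icc 0 T, Differentiable ℝ (b s)) → Differentiable ℝ (fun y => Y y t ω)) := by
  have hL := hF.nonneg (hθ.1.trans hθ.2)
  have hsub : Icc θ T ⊆ Icc 0 T := Icc_subset_Icc_left hθ.1
  have hb : ∀ t ∈ Icc θ T, ∀ x x' : ℝ, |b t x - b t x'| ≤ L * |x - x'| := fun t ht =>
    hF.lipschitz_drift t (hsub ht)
  have hlip : ∀ ω x x' f f', IsPath b (fun t => I t ω - I θ ω) θ T x f →
      IsPath b (fun t => I t ω - I θ ω) θ T x' f' →
      ∀ t ∈ Icc θ T, |f' t - f t| ≤ Real.exp (L * T) * |x' - x| := fun ω x x' f f' hf hf' t ht =>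
    (hf.abs_sub_le hθ.2 hb hL hf' ht).trans (by
      have : t - θ ≤ T := by linarith [ht.2, hθ.1]
      gcongr)
  obtain ⟨hex, hall⟩ := continuousVersion_of_pathwise (P := P) (X := Φ)
    (S := fun ω => IsPath b (fun t => I t ω - I θ ω) θ T) (Real.exp_pos (L * T)).le hlip
    (fun ω u F x f h1 h2 h3 => isJumpPath_zero_iff.1 (IsJumpPath.of_tendsto (γ := 0)
      ⟨le_rfl, hθ.2⟩ hb hL (fun y y' => by simpa using mul_nonneg hL (abs_nonneg (y - y')))
      (fun n => isJumpPath_zero_iff.2 (h1 n)) h2 h3)) fun y => (hΦ y).ae_isPath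
  refine ⟨hex, fun Y hY => ?_⟩
  filter_upwards [hall Y hY] with ω hω
  refine ⟨hω, fun t ht => ⟨derivativeBounded_of_lipschitz fun x x' =>
    hlip ω _ _ _ _ (hω x') (hω x) t ht, fun hdiff z => ?_⟩⟩
  exact IsPath.differentiableAt_param hθ.2 hb hL (fun s hs => hdiff s (hsub hs)) (u := id) hω
    differentiableAt_id ht

/-- The flow of the equation with a jump at time `θ`. -/
theorem jumpFlow (hF : ForwardAssumption T b σ β K L) (hθ : θ ∈ Icc 0 T)
    (hIcont : ∀ᵐ ω ∂P, ContinuousOn (fun t => I t ω) (Icc 0 T)) (hI0 : ∀ᵐ ω ∂P, I 0 ω = 0)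
    {X : ℝ → ℝ → Ω → ℝ} (hX : ∀ x, IsJumpSolution P ℱ T b β I θ x (X x)) :
    (∃ Y, IsContinuousVersion P 0 T X Y) ∧
    ∀ Y, IsContinuousVersion P 0 T X Y → ∀ᵐ ω ∂P, ∀ t ∈ Icc θ T,
      DerivativeBounded (fun x => Y x t ω) ((1 + L * Real.exp (L * T)) * Real.exp (L * T)) ∧
      ((∀ s ∈ Icc 0 T, Differentiable ℝ (b s)) → Differentiable ℝ (β θ) →
        Differentiable ℝ (fun x => Y x t ω)) := by
  have hT := hθ.1.trans hθ.2
  have hL := hF.nonneg hT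
  have hb := hF.lipschitz_drift
  have hβ := hF.lipschitz_jump θ hθ
  have hlip : ∀ ω x x' f f', IsJumpPath b (fun t => I t ω) (β θ) 0 θ T x f →
      IsJumpPath b (fun t => I t ω) (β θ) 0 θ T x' f' → ∀ t ∈ Icc 0 T,
      |f' t - f t| ≤ ((1 + L * Real.exp (L * T)) * Real.exp (L * T)) * |x' - x| :=
    fun ω x x' f f' hf hf' t ht => (hf.abs_sub_le hθ hb hL hβ hf' ht).trans (by
      have h1 : t - 0 ≤ T := by linarith [ht.2]
      -- The composition gives `(1 + L) * exp (L * T)`, which is at most the stated constant.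
      have h2 : L ≤ L * Real.exp (L * T) :=
        le_mul_of_one_le_right hL (Real.one_le_exp (mul_nonneg hL hT))
      gcongr)
  obtain ⟨hex, hall⟩ := continuousVersion_of_pathwise (P := P) (X := X)
    (S := fun ω => IsJumpPath b (fun t => I t ω) (β θ) 0 θ T) (by positivity) hlip
    (fun ω u F x f h1 h2 h3 => IsJumpPath.of_tendsto hθ hb hL hβ h1 h2 h3)
    fun x => (hX x).ae_isJumpPath hθ hIcont hI0
  refine ⟨hex, fun Y hY => ?_⟩
  filter_upwards [hall Y hY] with ω hω t ht
  refine ⟨derivativeBounded_of_lipschitz fun x x' =>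
    hlip ω _ _ _ _ (hω x') (hω x) t ⟨hθ.1.trans ht.1, ht.2⟩, fun hdiff hβdiff => ?_⟩
  exact IsJumpPath.differentiable_param hθ hb hL hdiff hβdiff hω ht

end Solutions

theorem proposition3p1 {Ω : Type*} [MeasurableSpace Ω] (P : Measure Ω) [IsProbabilityMeasure P]
    [P.IsComplete] (W : ℝ≥0 → Ω → ℝ) (hW : IsBrownianReal W P)
    (T : ℝ) (hT : 0 ≤ T) (b : ℝ → ℝ → ℝ) (σ : ℝ → ℝ) (β : ℝ → ℝ → ℝ)
    (hb : Measurable (Function.uncurry b)) (hσ : Measurable σ)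
    (hβ : Measurable (Function.uncurry β))
    (K L : ℝ) (hF : ForwardAssumption T b σ β K L)
    (I : ℝ → Ω → ℝ) (hI : IsWienerIntegral P W T σ I) :
    -- the derivative of `X⁰` with respect to `x`
    (∀ X₀ : ℝ → ℝ → Ω → ℝ,
      (∀ x, IsForwardSolution P (augmentedFiltration P W hW) T b I 0 x (X₀ x)) →
      (∃ Y, IsContinuousVersion P 0 T X₀ Y) ∧
      ∀ Y, IsContinuousVersion P 0 T X₀ Y → ∀ᵐ ω ∂P, ∀ t ∈ Icc 0 T,
        DerivativeBounded (fun x => Y x t ω) (Real.exp (L * T)) ∧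
        ((∀ s ∈ Icc 0 T, Differentiable ℝ (b s)) → Differentiable ℝ (fun x => Y x t ω))) ∧
    ∀ θ ∈ Icc 0 T,
      -- the derivative of `X¹(θ)` with respect to its value at time `θ`
      (∀ (x : ℝ) (X₁ : ℝ → Ω → ℝ),
        IsJumpSolution P (augmentedFiltration P W hW) T b β I θ x X₁ →
        ∀ Φ : ℝ → ℝ → Ω → ℝ,
        (∀ y, IsForwardSolution P (augmentedFiltration P W hW) T b I θ y (Φ y)) →
        (∃ Y, IsContinuousVersion P θ T Φ Y) ∧
        ∀ Y, IsContinuousVersion P θ T Φ Y → ∀ᵐ ω ∂P, ∀ t ∈ Icc θ T,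
          X₁ t ω = Y (X₁ θ ω) t ω ∧
          DerivativeBounded (fun y => Y y t ω) (Real.exp (L * T)) ∧
          ((∀ s ∈ Icc 0 T, Differentiable ℝ (b s)) → Differentiable ℝ (fun y => Y y t ω))) ∧
      -- the derivative of `X¹(θ)` with respect to `x`
      (∀ X₁ : ℝ → ℝ → Ω → ℝ,
        (∀ x, IsJumpSolution P (augmentedFiltration P W hW) T b β I θ x (X₁ x)) →
        (∃ Y, IsContinuousVersion P 0 T X₁ Y) ∧
        ∀ Y, IsContinuousVersion P 0 T X₁ Y → ∀ᵐ ω ∂P, ∀ t ∈ Icc θ T,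
          DerivativeBounded (fun x => Y x t ω)
            ((1 + L * Real.exp (L * T)) * Real.exp (L * T)) ∧
          ((∀ s ∈ Icc 0 T, Differentiable ℝ (b s)) → Differentiable ℝ (β θ) →
            Differentiable ℝ (fun x => Y x t ω))) := by
  have hI0 := hI.ae_zero hT
  refine ⟨fun X₀ hX₀ => ?_, fun θ hθ => ⟨fun x X₁ hX₁ Φ hΦ => ?_, fun X₁ hX₁ =>
    jumpFlow hF hθ hI.continuous hI0 hX₁⟩⟩
  · obtain ⟨hex, hall⟩ := forwardFlow hF ⟨le_rfl, hT⟩ hX₀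
    exact ⟨hex, fun Y hY => (hall Y hY).mono fun ω hω => hω.2⟩
  · obtain ⟨hex, hall⟩ := forwardFlow hF hθ hΦ
    refine ⟨hex, fun Y hY => ?_⟩
    filter_upwards [hall Y hY, hX₁.ae_isJumpPath hθ hI.continuous hI0] with ω hω hω₁ t ht
    refine ⟨?_, hω.2 t ht⟩
    -- The random datum `X₁ θ ω` may be inserted because `hω` covers all `y` off one null set; two
    -- solutions with equal datum coincide.
    have h := (hω.1 (X₁ θ ω)).sub_eq hθ.2
      (fun s hs => hF.lipschitz_drift s ⟨hθ.1.trans hs.1, hs.2⟩) (hF.nonneg hT)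
      (hω₁.isPath_after hθ) ht
    rw [sub_self, zero_mul] at h
    exact sub_eq_zero.1 h
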